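/- **Setting.** Consider a semi-Markov decision process with compact observable state space $\mathcal S\subset\mathbb R^d$ and $D\ge 1$ actions $\alpha\in\{1,\dots,D\}$ available at every state. The full state is $(s,\epsilon)$ with $s\in\mathcal S$ and $\epsilon=(\epsilon_1,\dots,\epsilon_D)\in\mathbb R^D$ (possibly unbounded). Taking action $\alpha$ in state $(s,\epsilon)$ gives the instantaneous reward $r_\alpha(s)+\epsilon_\alpha$, then a deterministic holding time $t_\alpha$ elapses (discount rate $\beta>0$ per unit time), and the next state $(s',\epsilon')$ is drawn from $\mathfrak p(s'\mid s,\alpha)\,\mathfrak q(\epsilon'\mid s')$, where $\mathfrak p(\cdot\mid s,\alpha)$ is a probability density with respect to a fixed $\sigma$-finite measure on $\mathcal S$ and $\mathfrak q(\cdot\mid s)$ is a probability density on $\mathbb R^D$ with respect to Lebesgue measure. For a sequence $\Pi=(\mu_0,\mu_1,\dots)$ of measurable maps $\mu_l:(s,\epsilon)\mapsto\alpha$, write $\mu_l$ also for the action $\mu_l(s_l,\epsilon_l)$ taken at stage $l$. The value function is $$V(s_0,\epsilon_0)=\sup_\Pi \mathbb E_\Pi\Big[\sum_{l\ge 0} e^{-\beta\sum_{e<l}t_{\mu_e}}\big(r_{\mu_l}(s_l)+\epsilon_{l,\mu_l}\big)\,\Big|\,s_0,\epsilon_0\Big].$$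 Let $\mathcal B$ be the Banach space of bounded continuous functions on $\mathcal S$ with the supremum norm. For $v\in\mathcal B$ put $E_\alpha v(s)=\int v(s')\,\mathfrak p(ds'\mid s,\alpha)$ and $$\Lambda(v)(s)=\int_{\mathbb R^D}\max_{\alpha}\big(r_\alpha(s)+e^{-\beta t_\alpha}E_\alpha v(s)+\epsilon_\alpha\big)\,\mathfrak q(d\epsilon\mid s).$$ **Assumptions.** 1. $\mathfrak q(\epsilon\mid s)$ is continuous in $\epsilon$ for each $s$ and in $s$ for each $\epsilon$. For each $\alpha$, $\mathfrak p(s'\mid s,\alpha)$ is continuous in $s'$ for each $s$ and in $s$ for each $s'$. The first absolute moment $\int\max_\alpha|\epsilon_\alpha|\,\mathfrak q(d\epsilon\mid s)$ is finite and continuous in $s$. 2. $\sum_{l\ge0}\delta^lR_l(s,\epsilon)<\infty$ for all $(s,\epsilon)$, where $\delta=\max_\alpha e^{-\beta t_\alpha}$, $R_0(s,\epsilon)=\max_\alpha|r_\alpha(s)+\epsilon_\alpha|$ and $R_{l+1}(s,\epsilon)=\max_\alpha\int\!\int R_l(s',\epsilon')\,\mathfrak q(d\epsilon'\mid s')\,\mathfrak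 p(ds'\mid s,\alpha)$. 3. $\delta<1$. 4. $r_\alpha\in\mathcal B$ for every $\alpha$. **Theorem.** For every policy sequence and every initial state, the discounted reward series converges almost surely and its sum is integrable, and the supremum defining $V$ is finite. The operator $\Lambda$ maps $\mathcal B$ into $\mathcal B$ and is a contraction with modulus $\delta$, i.e. $\|\Lambda v-\Lambda w\|_\infty\le\delta\|v-w\|_\infty$, so it has a unique fixed point $v\in\mathcal B$. Moreover $V(s,\cdot)$ is integrable with respect to $\mathfrak q(\cdot\mid s)$, $v(s)=\int V(s,\epsilon)\,\mathfrak q(d\epsilon\mid s)$ for all $s\in\mathcal S$, and $$V(s,\epsilon)=\max_{\alpha}\big[r_\alpha(s)+e^{-\beta t_\alpha}E_\alpha v(s)+\epsilon_\alpha\big]\qquad\text{for all }(s,\epsilon).$$ -/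

import Mathlib

open MeasureTheory ProbabilityTheory
open scoped ENNReal BoundedContinuousFunction

noncomputable section

/-- A semi-Markov decision process with observable state space `S ⊆ ℝᵈ` (compact), `D` actions at
every state, unobserved additive rewards `ε ∈ ℝᴰ` (possibly unbounded), deterministic holding times,
and conditionally independent transitions `π(s', ε' | s, ε, α) = p(s' | s, α) q(ε' | s')`. -/
structure SMDP (d D : ℕ) where
  /-- the observable state space -/
  S : Set (EuclideanSpace ℝ (Fin d))
  isCompact_S : IsCompact S
  /-- the measure on `S` with respect to which `p` is a density (for instance Lebesgue measure, or
  counting measure when `S` is finite) -/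
  refMeasure : Measure S
  sigmaFinite_refMeasure : SigmaFinite refMeasure
  /-- `p s α s'` is the transition density `p(s' | s, α)` -/
  p : S → Fin D → S → ℝ
  measurable_p : Measurable fun x : (S × Fin D) × S => p x.1.1 x.1.2 x.2
  p_nonneg : ∀ s α s', 0 ≤ p s α s'
  lintegral_p : ∀ s α, ∫⁻ s', ENNReal.ofReal (p s α s') ∂refMeasure = 1
  /-- `q s ε` is the Lebesgue density `q(ε | s)` of the unobserved rewards at `s` -/
  q : S → (Fin D → ℝ) → ℝ
  measurable_q : Measurable fun x : S × (Fin D → ℝ) => q x.1 x.2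
  q_nonneg : ∀ s ε, 0 ≤ q s ε
  lintegral_q : ∀ s, ∫⁻ ε, ENNReal.ofReal (q s ε) = 1
  /-- `r α s` is the observable reward of action `α` at `s` -/
  r : Fin D → S → ℝ
  /-- `t α` is the holding time of action `α` -/
  t : Fin D → ℝ
  /-- the discount rate per unit time -/
  β : ℝ
  β_pos : 0 < β

namespace SMDP

variable {d D : ℕ}

/-- The full state space: pairs `(s, ε)`. -/
abbrev State (M : SMDP d D) : Type := M.S × (Fin D → ℝ)

instance (M : SMDP d D) : SigmaFinite M.refMeasure := M.sigmaFinite_refMeasure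

/-- The kernel `p(ds' | s, α)`. -/
def obsKernel (M : SMDP d D) : Kernel (M.S × Fin D) M.S :=
  Kernel.withDensity (Kernel.const (M.S × Fin D) M.refMeasure)
    fun x s' => ENNReal.ofReal (M.p x.1 x.2 s')

/-- The kernel `q(dε | s)`. -/
def shockKernel (M : SMDP d D) : Kernel M.S (Fin D → ℝ) :=
  Kernel.withDensity (Kernel.const M.S (volume : Measure (Fin D → ℝ)))
    fun s ε => ENNReal.ofReal (M.q s ε)

theorem obsKernel_apply (M : SMDP d D) (s : M.S) (α : Fin D) :
    M.obsKernel (s, α) = M.refMeasure.withDensity fun s' => ENNReal.ofReal (M.p s α s') := by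
  rw [obsKernel, Kernel.withDensity_apply _ (by exact M.measurable_p.ennreal_ofReal),
    Kernel.const_apply]

theorem shockKernel_apply (M : SMDP d D) (s : M.S) :
    M.shockKernel s = volume.withDensity fun ε => ENNReal.ofReal (M.q s ε) := by
  rw [shockKernel, Kernel.withDensity_apply _ (by exact M.measurable_q.ennreal_ofReal),
    Kernel.const_apply]

instance (M : SMDP d D) : IsMarkovKernel M.obsKernel :=
  ⟨fun x => ⟨by
    obtain ⟨s, α⟩ := x
    rw [obsKernel_apply, withDensity_apply _ MeasurableSet.univ, Measure.restrict_univ,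
      M.lintegral_p]⟩⟩

instance (M : SMDP d D) : IsMarkovKernel M.shockKernel :=
  ⟨fun s => ⟨by
    rw [shockKernel_apply, withDensity_apply _ MeasurableSet.univ, Measure.restrict_univ,
      M.lintegral_q]⟩⟩

/-- The transition kernel on the full state space: given the observable state `s` and the action
`α`, draw `s'` from `p(ds' | s, α)` and then `ε'` from `q(dε' | s')`. -/
def transKernel (M : SMDP d D) : Kernel (M.S × Fin D) M.State :=
  M.obsKernel ⊗ₖ Kernel.prodMkLeft (M.S × Fin D) M.shockKernel

instance (M : SMDP d D) : IsMarkovKernel M.transKernel := by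
  unfold transKernel; infer_instance

/-- A policy: a sequence `μ₀, μ₁, …` of (measurable) Markovian decision rules. -/
def Policy (M : SMDP d D) : Type :=
  {μ : ℕ → M.State → Fin D // ∀ l, Measurable (μ l)}

/-- The law of the state at stage `l + 1` given the states up to stage `l`, under a policy. -/
def stepKernel (M : SMDP d D) (μ : M.Policy) (l : ℕ) :
    Kernel ((i : Finset.Iic l) → M.State) M.State :=
  M.transKernel.comap
    (fun h => ((h ⟨l, Finset.mem_Iic.2 le_rfl⟩).1, μ.1 l (h ⟨l, Finset.mem_Iic.2 le_rfl⟩)))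
    (((measurable_pi_apply _).fst).prodMk ((μ.2 l).comp (measurable_pi_apply _)))

instance (M : SMDP d D) (μ : M.Policy) (l : ℕ) : IsMarkovKernel (M.stepKernel μ l) := by
  unfold stepKernel; infer_instance

/-- The law of the state sequence `(s₀, ε₀), (s₁, ε₁), …` under the policy `μ`, started at `x`
(the Ionescu-Tulcea measure). -/
def law (M : SMDP d D) (μ : M.Policy) (x : M.State) : Measure (ℕ → M.State) :=
  Kernel.traj (X := fun _ => M.State) (M.stepKernel μ) 0 (fun _ => x)

/-- The reward at stage `l` along a state sequence, discounted to stage `0`. -/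
def discountedReward (M : SMDP d D) (μ : M.Policy) (ω : ℕ → M.State) (l : ℕ) : ℝ :=
  Real.exp (-M.β * ∑ e ∈ Finset.range l, M.t (μ.1 e (ω e))) *
    (M.r (μ.1 l (ω l)) (ω l).1 + (ω l).2 (μ.1 l (ω l)))

/-- The total discounted return along a state sequence. -/
def totalReturn (M : SMDP d D) (μ : M.Policy) (ω : ℕ → M.State) : ℝ :=
  ∑' l, M.discountedReward μ ω l

/-- The expected total discounted return of a policy from an initial state. -/
def expectedReturn (M : SMDP d D) (μ : M.Policy) (x : M.State) : ℝ :=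
  ∫ ω, M.totalReturn μ ω ∂(M.law μ x)

/-- The state value function `V(s, ε)`. -/
def V (M : SMDP d D) (x : M.State) : ℝ :=
  ⨆ μ : M.Policy, M.expectedReturn μ x

/-- `E_α v(s) = ∫ v(s') p(ds' | s, α)`. -/
def condExpect (M : SMDP d D) (α : Fin D) (v : M.S → ℝ) (s : M.S) : ℝ :=
  ∫ s', v s' ∂(M.obsKernel (s, α))

/-- The maximum of finitely many reals. -/
def maxOver [NeZero D] (f : Fin D → ℝ) : ℝ :=
  Finset.univ.sup' Finset.univ_nonempty f

/-- The social surplus `G` at the observable state `s`: `∫ max_α (η_α + ε_α) q(dε | s)`. -/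
def socialSurplus [NeZero D] (M : SMDP d D) (s : M.S) (η : Fin D → ℝ) : ℝ :=
  ∫ ε, maxOver (fun α => η α + ε α) ∂(M.shockKernel s)

/-- The expected Bellman operator
`v ↦ (s ↦ G(r_1(s) + e^{-β t_1} E_1 v(s), …, r_D(s) + e^{-β t_D} E_D v(s)))`. -/
def bellman [NeZero D] (M : SMDP d D) (v : M.S → ℝ) (s : M.S) : ℝ :=
  M.socialSurplus s fun α => M.r α s + Real.exp (-M.β * M.t α) * M.condExpect α v s

/-- `δ = sup_α e^{-β t_α}`. -/
def δ [NeZero D] (M : SMDP d D) : ℝ :=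
  maxOver fun α => Real.exp (-M.β * M.t α)

/-- The densities `q(ε | s)` and `p(s' | s, α)` are continuous in each of their two continuous
variables. -/
structure ContinuousDensities (M : SMDP d D) : Prop where
  q_shock : ∀ s, Continuous fun ε => M.q s ε
  q_state : ∀ ε, Continuous fun s => M.q s ε
  p_next : ∀ s α, Continuous fun s' => M.p s α s'
  p_state : ∀ α s', Continuous fun s => M.p s α s'

/-- The first absolute moment of the unobserved rewards is finite and continuous in the observable
state. Here `‖ε‖ = max_α |ε_α|`. -/
structure ContinuousShockMoment (M : SMDP d D) : Prop where
  integrable : ∀ s, Integrable (fun ε : Fin D → ℝ => ‖ε‖) (M.shockKernel s)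
  continuous : Continuous fun s => ∫ ε, ‖ε‖ ∂(M.shockKernel s)

/-- `R_l(s, ε)`: the bound on the expected reward at stage `l` when started at `(s, ε)`. -/
def R [NeZero D] (M : SMDP d D) : ℕ → M.State → ℝ≥0∞
  | 0 => fun x => ENNReal.ofReal (maxOver fun α => |M.r α x.1 + x.2 α|)
  | l + 1 => fun x =>
      ⨆ α : Fin D, ∫⁻ s', ∫⁻ ε', M.R l (s', ε') ∂(M.shockKernel s') ∂(M.obsKernel (x.1, α))

/-- The discounted total return is finite: `∑ δ^l R_l(s, ε) < ∞` for all `(s, ε)`. -/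
def FiniteDiscountedReturn [NeZero D] (M : SMDP d D) : Prop :=
  ∀ x, ∑' l, ENNReal.ofReal (M.δ ^ l) * M.R l x < ∞

/-- The observable rewards are bounded continuous functions on `S`. -/
def BoundedObservableReward (M : SMDP d D) : Prop :=
  ∀ α, Continuous (M.r α) ∧ ∃ C, ∀ s, |M.r α s| ≤ C

end SMDP

end

/-!
The argument is dynamic programming, with the unbounded shocks controlled by the hypotheses on
their first moment (continuity) and on `R` (tails).

*The Bellman operator.* Densities that depend continuously on a parameter and keep a convergent
integral converge in `L¹` (Scheffé). With the envelope `C + ‖ε‖`, whose integral is continuous by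
the moment assumption, this gives a dominated convergence theorem with a moving dominating function
(`continuous_integral_mul_density`). Hence the expected Bellman operator preserves continuity;
compactness of the state space then gives boundedness. Both `max` and integration against a
probability measure are `1`-Lipschitz for the supremum norm, so the operator is a contraction with
modulus `δ` (`contractingWith_bellmanBCF`), and Banach's theorem provides the fixed point `v`.

*Absolute convergence.* By the Markov property the expectation of `R k` at stage `n` is at most
`R (k + n)` at the initial state (`lintegral_R_law_le`), so the reward at stage `l` has discounted
first absolute moment at most `δ ^ l * R l`, which is summable by hypothesis.

*Verification.* Let `W (s, ε)` be the maximum over actions of the reward plus the discounted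
expectation of `v` (`optimalActionValue`). Since `v` is a fixed point, the average of `W` over the
next full state is `E_α v`. Hence, under any policy, the expected rewards of the first `n` stages
plus the expectation of the discounted `W` at stage `n` are at most `W` at the initial state,
with equality for a policy that always maximizes (a measurable choice is possible since there are
finitely many actions). As `|W| ≤ ‖v‖ + R 0`, the remainder is at most `δ ^ n * (‖v‖ + R n)`, which
tends to `0`; so `W` is an upper bound for all expected returns, and it is attained.
-/

noncomputable section

/-! ### Generalized dominated convergence -/

section GeneralizedDominatedConvergence

open Filter Topology

variable {Y ι : Type*} [MeasurableSpace Y] {ν : Measure Y} {l : Filter ι} [l.IsCountablyGenerated]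

/-- Scheffé's lemma: for nonnegative functions, pointwise convergence together with convergence of
the integrals implies convergence in `L¹`. -/
theorem tendsto_integral_abs_sub_of_tendsto_integral {g : ι → Y → ℝ} {g₀ : Y → ℝ}
    (hg : ∀ i, Integrable (g i) ν) (hg₀ : Integrable g₀ ν)
    (hnn : ∀ i y, 0 ≤ g i y) (hnn₀ : ∀ y, 0 ≤ g₀ y)
    (hlim : ∀ y, Tendsto (fun i => g i y) l (𝓝 (g₀ y)))
    (hint : Tendsto (fun i => ∫ y, g i y ∂ν) l (𝓝 (∫ y, g₀ y ∂ν))) :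
    Tendsto (fun i => ∫ y, |g i y - g₀ y| ∂ν) l (𝓝 0) := by
  -- The negative part of `g i - g₀` is dominated by `g₀`.
  have hpos : Tendsto (fun i => ∫ y, max (g₀ y - g i y) 0 ∂ν) l (𝓝 (∫ _, (0 : ℝ) ∂ν)) := by
    refine tendsto_integral_filter_of_dominated_convergence g₀
      (Eventually.of_forall fun i => ((hg₀.sub (hg i)).pos_part).aestronglyMeasurable)
      (Eventually.of_forall fun i => Eventually.of_forall fun y => ?_) hg₀
      (Eventually.of_forall fun y => ?_)
    · rw [Real.norm_of_nonneg (le_max_right _ _)]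
      exact max_le (by linarith [hnn i y]) (hnn₀ y)
    · have := ((tendsto_const_nhds (x := g₀ y)).sub (hlim y)).max (tendsto_const_nhds (x := (0 : ℝ)))
      simpa using this
  have hsum := (hint.sub (tendsto_const_nhds (x := ∫ y, g₀ y ∂ν))).add (hpos.const_mul 2)
  simp only [integral_zero, sub_self, mul_zero, add_zero] at hsum
  refine hsum.congr fun i => ?_
  have h1 : Integrable (fun y => g i y - g₀ y) ν := (hg i).sub hg₀
  have h2 : Integrable (fun y => 2 * max (g₀ y - g i y) 0) ν :=
    ((hg₀.sub (hg i)).pos_part).const_mul 2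
  rw [← integral_sub (hg i) hg₀, ← integral_const_mul, ← integral_add h1 h2]
  refine integral_congr_ae (Eventually.of_forall fun y => ?_)
  simp only
  rcases le_total (g₀ y) (g i y) with h | h
  · rw [max_eq_right (by linarith), abs_of_nonneg (by linarith)]; ring
  · rw [max_eq_left (by linarith), abs_of_nonpos (by linarith)]; ring

/-- Dominated convergence with a varying dominating function `g i` whose integrals converge. -/
theorem tendsto_integral_of_dominated_of_tendsto_integral {h g : ι → Y → ℝ} {h₀ g₀ : Y → ℝ}
    (hg : ∀ i, Integrable (g i) ν) (hg₀ : Integrable g₀ ν) (hh : ∀ i, Integrable (h i) ν)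
    (hle : ∀ i y, |h i y| ≤ g i y) (hle₀ : ∀ y, |h₀ y| ≤ g₀ y)
    (hlim : ∀ y, Tendsto (fun i => g i y) l (𝓝 (g₀ y)))
    (hlim' : ∀ y, Tendsto (fun i => h i y) l (𝓝 (h₀ y)))
    (hint : Tendsto (fun i => ∫ y, g i y ∂ν) l (𝓝 (∫ y, g₀ y ∂ν))) :
    Tendsto (fun i => ∫ y, h i y ∂ν) l (𝓝 (∫ y, h₀ y ∂ν)) := by
  have hnn : ∀ i y, 0 ≤ g i y := fun i y => (abs_nonneg _).trans (hle i y)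
  have hnn₀ : ∀ y, 0 ≤ g₀ y := fun y => (abs_nonneg _).trans (hle₀ y)
  have hL1 := tendsto_integral_abs_sub_of_tendsto_integral hg hg₀ hnn hnn₀ hlim hint
  -- Truncating `h i` to `[-g₀, g₀]` gives a dominated family; the error is at most `|g i - g₀|`.
  let c : ι → Y → ℝ := fun i y => max (-g₀ y) (min (h i y) (g₀ y))
  have hc_le : ∀ i y, |c i y| ≤ g₀ y := fun i y =>
    abs_le.2 ⟨le_max_left _ _, max_le (by linarith [hnn₀ y]) (min_le_right _ _)⟩
  have hc_meas : ∀ i, AEStronglyMeasurable (c i) ν := fun i =>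
    hg₀.aestronglyMeasurable.neg.sup ((hh i).aestronglyMeasurable.inf hg₀.aestronglyMeasurable)
  have hc_int : ∀ i, Integrable (c i) ν := fun i =>
    hg₀.mono' (hc_meas i) (Eventually.of_forall fun y => hc_le i y)
  have hc : Tendsto (fun i => ∫ y, c i y ∂ν) l (𝓝 (∫ y, h₀ y ∂ν)) := by
    refine tendsto_integral_filter_of_dominated_convergence g₀ (Eventually.of_forall hc_meas)
      (Eventually.of_forall fun i => Eventually.of_forall fun y => hc_le i y) hg₀
      (Eventually.of_forall fun y => ?_)
    have := (tendsto_const_nhds (x := -g₀ y)).max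
      ((hlim' y).min (tendsto_const_nhds (x := g₀ y)))
    rwa [min_eq_left (abs_le.1 (hle₀ y)).2, max_eq_right (abs_le.1 (hle₀ y)).1] at this
  have hdiff : Tendsto (fun i => ∫ y, h i y - c i y ∂ν) l (𝓝 0) := by
    refine squeeze_zero_norm (fun i => ?_) hL1
    refine norm_integral_le_of_norm_le ((hg i).sub hg₀).abs (Eventually.of_forall fun y => ?_)
    have h1 := abs_le.1 (hle i y)
    have h2 := le_abs_self (g i y - g₀ y)
    rw [Real.norm_eq_abs, abs_le]
    have h3 := abs_nonneg (g i y - g₀ y)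
    have h4 := hnn₀ y
    simp only [c]
    rcases le_total (h i y) (g₀ y) with h5 | h5
    · rw [min_eq_left h5]
      rcases le_total (-g₀ y) (h i y) with h6 | h6
      · rw [max_eq_right h6]; constructor <;> linarith
      · rw [max_eq_left h6]; constructor <;> linarith
    · rw [min_eq_right h5, max_eq_right (by linarith)]; constructor <;> linarith
  have := hdiff.add hc
  rw [zero_add] at this
  refine this.congr fun i => ?_
  rw [integral_sub (hh i) (hc_int i)]; ring

end GeneralizedDominatedConvergence

/-- Integrating a family of functions with envelope `m` against a family of densities, both
continuous in the parameter, is continuous as soon as the integral of the envelope is. -/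
theorem continuous_integral_mul_density {X Y : Type*} [TopologicalSpace X]
    [FirstCountableTopology X] [MeasurableSpace Y] {ν : Measure Y} {k φ : X → Y → ℝ} {m : Y → ℝ}
    (hk_nn : ∀ x y, 0 ≤ k x y) (hk_cont : ∀ y, Continuous fun x => k x y)
    (hk_meas : ∀ x, Measurable (k x))
    (hφ_cont : ∀ y, Continuous fun x => φ x y) (hφ_meas : ∀ x, Measurable (φ x))
    (hφ_le : ∀ x y, |φ x y| ≤ m y)
    (hm_int : ∀ x, Integrable (fun y => k x y * m y) ν)
    (hm_cont : Continuous fun x => ∫ y, k x y * m y ∂ν) :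
    Continuous fun x => ∫ y, k x y * φ x y ∂ν := by
  have hle : ∀ x y, |k x y * φ x y| ≤ k x y * m y := fun x y => by
    rw [abs_mul, abs_of_nonneg (hk_nn x y)]
    exact mul_le_mul_of_nonneg_left (hφ_le x y) (hk_nn x y)
  refine continuous_iff_continuousAt.2 fun x => ?_
  exact tendsto_integral_of_dominated_of_tendsto_integral hm_int (hm_int x)
    (fun i => (hm_int i).mono' ((hk_meas i).mul (hφ_meas i)).aestronglyMeasurable
      (Filter.Eventually.of_forall fun y => hle i y))
    hle (hle x) (fun y => ((hk_cont y).mul continuous_const).tendsto x)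
    (fun y => ((hk_cont y).mul (hφ_cont y)).tendsto x) (hm_cont.tendsto x)

namespace SMDP

/-! ### Finite maxima -/

section MaxOver

variable {D : ℕ} [NeZero D]

theorem le_maxOver (f : Fin D → ℝ) (α : Fin D) : f α ≤ maxOver f :=
  Finset.le_sup' f (Finset.mem_univ α)

theorem maxOver_le {f : Fin D → ℝ} {c : ℝ} (h : ∀ α, f α ≤ c) : maxOver f ≤ c :=
  Finset.sup'_le _ _ fun α _ => h α

theorem exists_eq_maxOver (f : Fin D → ℝ) : ∃ α, f α = maxOver f := by
  obtain ⟨α, -, h⟩ := Finset.exists_mem_eq_sup' Finset.univ_nonempty f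
  exact ⟨α, h.symm⟩

theorem abs_maxOver_le {f : Fin D → ℝ} {c : ℝ} (h : ∀ α, |f α| ≤ c) : |maxOver f| ≤ c := by
  obtain ⟨α, hα⟩ := exists_eq_maxOver f
  rw [← hα]; exact h α

theorem abs_maxOver_sub_le {f g : Fin D → ℝ} {c : ℝ} (h : ∀ α, |f α - g α| ≤ c) :
    |maxOver f - maxOver g| ≤ c := by
  rw [abs_sub_le_iff, sub_le_iff_le_add, sub_le_iff_le_add]
  refine ⟨maxOver_le fun α => ?_, maxOver_le fun α => ?_⟩
  · linarith [(abs_le.1 (h α)).2, le_maxOver g α]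
  · linarith [(abs_le.1 (h α)).1, le_maxOver f α]

theorem continuous_maxOver : Continuous (maxOver : (Fin D → ℝ) → ℝ) :=
  Continuous.finset_sup'_apply Finset.univ_nonempty fun α _ => continuous_apply α

theorem measurable_maxOver {X : Type*} [MeasurableSpace X] {f : X → Fin D → ℝ}
    (hf : ∀ α, Measurable fun x => f x α) : Measurable fun x => maxOver (f x) :=
  continuous_maxOver.measurable.comp (measurable_pi_lambda _ hf)

/-- A measurable family of real vectors has a measurable maximizing index. -/
theorem exists_measurable_eq_maxOver {X : Type*} [MeasurableSpace X] {f : X → Fin D → ℝ}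
    (hf : ∀ α, Measurable fun x => f x α) :
    ∃ g : X → Fin D, Measurable g ∧ ∀ x, f x (g x) = maxOver (f x) := by
  classical
  -- The smallest maximizing index is a measurable choice.
  have hex : ∀ x, ∃ α, f x α = maxOver (f x) ∧ ∀ α' < α, f x α' ≠ maxOver (f x) := fun x => by
    obtain ⟨α, h, hmin⟩ := WellFounded.has_min (wellFounded_lt (α := Fin D))
      {α | f x α = maxOver (f x)} (exists_eq_maxOver (f x))
    exact ⟨α, h, fun α' hlt h' => hmin α' h' hlt⟩
  choose g hg hmin using hex
  refine ⟨g, measurable_to_countable' fun α => ?_, hg⟩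
  have : g ⁻¹' {α} = {x | f x α = maxOver (f x)} ∩ ⋂ α' : Fin D, ⋂ _ : α' < α,
      {x | f x α' = maxOver (f x)}ᶜ := by
    ext x
    simp only [Set.mem_preimage, Set.mem_singleton_iff, Set.mem_inter_iff, Set.mem_ofPred_eq,
      Set.mem_iInter, Set.mem_compl_iff]
    constructor
    · rintro rfl
      exact ⟨hg x, hmin x⟩
    · rintro ⟨h1, h2⟩
      rcases lt_trichotomy (g x) α with h | h | h
      · exact absurd (hg x) (h2 _ h)
      · exact h
      · exact absurd h1 (hmin x α h)
  rw [this]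
  exact (measurableSet_eq_fun (hf α) (measurable_maxOver hf)).inter
    (MeasurableSet.iInter fun α' => MeasurableSet.iInter fun _ =>
      (measurableSet_eq_fun (hf α') (measurable_maxOver hf)).compl)

end MaxOver

/-! ### The expected Bellman operator on bounded continuous functions -/

variable {d D : ℕ}

theorem abs_integral_le_of_abs_le {Y : Type*} [MeasurableSpace Y] {ν : Measure Y}
    [IsProbabilityMeasure ν] {f : Y → ℝ} {C : ℝ} (h : ∀ y, |f y| ≤ C) : |∫ y, f y ∂ν| ≤ C := by
  have := norm_integral_le_of_norm_le_const (μ := ν) (f := f) (Filter.Eventually.of_forall h)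
  rwa [probReal_univ, mul_one] at this

theorem measurable_p_right (M : SMDP d D) (s : M.S) (α : Fin D) : Measurable (M.p s α) :=
  M.measurable_p.comp (measurable_prodMk_left (x := (s, α)))

theorem measurable_q_right (M : SMDP d D) (s : M.S) : Measurable (M.q s) :=
  M.measurable_q.comp measurable_prodMk_left

theorem integral_obsKernel (M : SMDP d D) (s : M.S) (α : Fin D) (f : M.S → ℝ) :
    ∫ s', f s' ∂(M.obsKernel (s, α)) = ∫ s', M.p s α s' * f s' ∂M.refMeasure := by
  have hm := M.measurable_p_right s α
  rw [obsKernel_apply, integral_withDensity_eq_integral_toReal_smul hm.ennreal_ofReal (by simp)]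
  simp [ENNReal.toReal_ofReal (M.p_nonneg _ _ _)]

theorem integral_shockKernel (M : SMDP d D) (s : M.S) (f : (Fin D → ℝ) → ℝ) :
    ∫ ε, f ε ∂(M.shockKernel s) = ∫ ε, M.q s ε * f ε := by
  have hm := M.measurable_q_right s
  rw [shockKernel_apply, integral_withDensity_eq_integral_toReal_smul hm.ennreal_ofReal (by simp)]
  simp [ENNReal.toReal_ofReal (M.q_nonneg _ _)]

theorem integrable_obsKernel_iff (M : SMDP d D) (s : M.S) (α : Fin D) (f : M.S → ℝ) :
    Integrable f (M.obsKernel (s, α)) ↔ Integrable (fun s' => M.p s α s' * f s') M.refMeasure := by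
  have hm := M.measurable_p_right s α
  rw [obsKernel_apply, integrable_withDensity_iff_integrable_smul' hm.ennreal_ofReal (by simp)]
  simp [ENNReal.toReal_ofReal (M.p_nonneg _ _ _)]

theorem integrable_shockKernel_iff (M : SMDP d D) (s : M.S) (f : (Fin D → ℝ) → ℝ) :
    Integrable f (M.shockKernel s) ↔ Integrable (fun ε => M.q s ε * f ε) := by
  have hm := M.measurable_q_right s
  rw [shockKernel_apply, integrable_withDensity_iff_integrable_smul' hm.ennreal_ofReal (by simp)]
  simp [ENNReal.toReal_ofReal (M.q_nonneg _ _)]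

theorem abs_condExpect_sub_le (M : SMDP d D) (v w : M.S →ᵇ ℝ) (α : Fin D) (s : M.S) :
    |M.condExpect α v s - M.condExpect α w s| ≤ dist v w := by
  rw [condExpect, condExpect, ← integral_sub (v.integrable _) (w.integrable _)]
  refine abs_integral_le_of_abs_le fun s' => ?_
  rw [← Real.dist_eq]
  exact BoundedContinuousFunction.dist_coe_le_dist s'

theorem abs_condExpect_le (M : SMDP d D) (v : M.S →ᵇ ℝ) (α : Fin D) (s : M.S) :
    |M.condExpect α v s| ≤ ‖v‖ :=
  abs_integral_le_of_abs_le v.norm_coe_le_norm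

/-- Transition densities that converge pointwise converge in `L¹`, so `E_α` maps bounded continuous
functions to continuous ones. -/
theorem continuous_condExpect (M : SMDP d D) (hcont : M.ContinuousDensities) (v : M.S →ᵇ ℝ)
    (α : Fin D) : Continuous (M.condExpect α v) := by
  have hconst : ∀ s, ∫ s', M.p s α s' * ‖v‖ ∂M.refMeasure = ‖v‖ := fun s => by
    rw [← M.integral_obsKernel s α fun _ => ‖v‖, integral_const, probReal_univ, one_smul]
  have := continuous_integral_mul_density (ν := M.refMeasure) (k := fun s s' => M.p s α s')
    (φ := fun _ s' => v s') (m := fun _ => ‖v‖) (fun s s' => M.p_nonneg s α s')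
    (fun s' => hcont.p_state α s') (M.measurable_p_right · α) (fun _ => continuous_const)
    (fun _ => v.continuous.measurable) (fun _ s' => v.norm_coe_le_norm s')
    (fun s => (M.integrable_obsKernel_iff s α _).1 (integrable_const _))
    (continuous_const.congr fun s => (hconst s).symm)
  refine this.congr fun s => ?_
  rw [condExpect, integral_obsKernel]

variable [NeZero D]

theorem abs_maxOver_add_le {η ε : Fin D → ℝ} {C : ℝ} (hη : ∀ α, |η α| ≤ C) :
    |maxOver fun α => η α + ε α| ≤ C + ‖ε‖ :=
  abs_maxOver_le fun α => (abs_add_le _ _).trans (add_le_add (hη α) (norm_le_pi_norm ε α))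

theorem integrable_maxOver_add (M : SMDP d D) (hmoment : M.ContinuousShockMoment) (s : M.S)
    (η : Fin D → ℝ) : Integrable (fun ε => maxOver fun α => η α + ε α) (M.shockKernel s) := by
  refine ((integrable_const (‖η‖ : ℝ)).add (hmoment.integrable s)).mono' ?_
    (Filter.Eventually.of_forall fun ε => abs_maxOver_add_le fun α => norm_le_pi_norm η α)
  exact (measurable_maxOver fun α =>
    measurable_const.add (measurable_pi_apply α)).aestronglyMeasurable

theorem abs_socialSurplus_sub_le (M : SMDP d D) (hmoment : M.ContinuousShockMoment) (s : M.S)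
    {η η' : Fin D → ℝ} {C : ℝ} (h : ∀ α, |η α - η' α| ≤ C) :
    |M.socialSurplus s η - M.socialSurplus s η'| ≤ C := by
  rw [socialSurplus, socialSurplus, ← integral_sub (M.integrable_maxOver_add hmoment s η)
    (M.integrable_maxOver_add hmoment s η')]
  refine abs_integral_le_of_abs_le fun ε => ?_
  exact abs_maxOver_sub_le fun α => by simpa using h α

theorem continuous_socialSurplus (M : SMDP d D) (hcont : M.ContinuousDensities)
    (hmoment : M.ContinuousShockMoment) {η : M.S → Fin D → ℝ}
    (hη : ∀ α, Continuous fun s => η s α) {C : ℝ} (hC : ∀ s α, |η s α| ≤ C) :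
    Continuous fun s => M.socialSurplus s (η s) := by
  have hint : ∀ s, Integrable (fun ε : Fin D → ℝ => C + ‖ε‖) (M.shockKernel s) := fun s =>
    (integrable_const C).add (hmoment.integrable s)
  have hval : ∀ s, ∫ ε, M.q s ε * (C + ‖ε‖) = C + ∫ ε, ‖ε‖ ∂(M.shockKernel s) := fun s => by
    rw [← M.integral_shockKernel s fun ε => C + ‖ε‖,
      integral_add (integrable_const C) (hmoment.integrable s)]
    simp
  have := continuous_integral_mul_density (ν := (volume : Measure (Fin D → ℝ)))
    (k := fun s ε => M.q s ε) (φ := fun s ε => maxOver fun α => η s α + ε α)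
    (m := fun ε => C + ‖ε‖) (fun s ε => M.q_nonneg s ε)
    (fun ε => hcont.q_state ε) M.measurable_q_right
    (fun ε => continuous_maxOver.comp (continuous_pi fun α => (hη α).add continuous_const))
    (fun s => measurable_maxOver fun α => measurable_const.add (measurable_pi_apply α))
    (fun s ε => abs_maxOver_add_le (hC s))
    (fun s => (M.integrable_shockKernel_iff s _).1 (hint s))
    ((continuous_const.add hmoment.continuous).congr fun s => (hval s).symm)
  refine this.congr fun s => ?_
  rw [socialSurplus, integral_shockKernel]

theorem exp_le_δ (M : SMDP d D) (α : Fin D) : Real.exp (-M.β * M.t α) ≤ M.δ :=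
  le_maxOver (fun α => Real.exp (-M.β * M.t α)) α

theorem δ_pos (M : SMDP d D) : 0 < M.δ :=
  (Real.exp_pos _).trans_le (M.exp_le_δ 0)

theorem abs_exp_mul_condExpect_le (M : SMDP d D) (hδ : M.δ < 1) (v : M.S →ᵇ ℝ) (α : Fin D)
    (s : M.S) : |Real.exp (-M.β * M.t α) * M.condExpect α v s| ≤ ‖v‖ := by
  rw [abs_mul, abs_of_pos (Real.exp_pos _)]
  exact (mul_le_of_le_one_left (abs_nonneg _) ((M.exp_le_δ α).trans hδ.le)).trans
    (M.abs_condExpect_le v α s)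

theorem BoundedObservableReward.exists_bound {M : SMDP d D} (hr : M.BoundedObservableReward) :
    ∃ C, ∀ α s, |M.r α s| ≤ C := by
  choose C hC using fun α => (hr α).2
  exact ⟨maxOver C, fun α s => (hC α s).trans (le_maxOver C α)⟩

theorem continuous_bellman (M : SMDP d D) (hcont : M.ContinuousDensities)
    (hmoment : M.ContinuousShockMoment) (hδ : M.δ < 1) (hr : M.BoundedObservableReward)
    (v : M.S →ᵇ ℝ) : Continuous (M.bellman v) := by
  obtain ⟨C, hC⟩ := hr.exists_bound
  exact M.continuous_socialSurplus hcont hmoment (C := C + ‖v‖)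
    (fun α => (hr α).1.add (continuous_const.mul (M.continuous_condExpect hcont v α)))
    fun s α => (abs_add_le _ _).trans (add_le_add (hC α s) (M.abs_exp_mul_condExpect_le hδ v α s))

theorem abs_bellman_sub_le (M : SMDP d D) (hmoment : M.ContinuousShockMoment)
    (v w : M.S →ᵇ ℝ) (s : M.S) : |M.bellman v s - M.bellman w s| ≤ M.δ * dist v w := by
  refine M.abs_socialSurplus_sub_le hmoment s fun α => ?_
  rw [add_sub_add_left_eq_sub, ← mul_sub, abs_mul, abs_of_pos (Real.exp_pos _)]
  exact mul_le_mul (M.exp_le_δ α) (M.abs_condExpect_sub_le v w α s) (abs_nonneg _) M.δ_pos.le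

/-- The expected Bellman operator on the Banach space of bounded continuous functions. -/
def bellmanBCF (M : SMDP d D) (hcont : M.ContinuousDensities)
    (hmoment : M.ContinuousShockMoment) (hδ : M.δ < 1) (hr : M.BoundedObservableReward)
    (v : M.S →ᵇ ℝ) : M.S →ᵇ ℝ :=
  haveI : CompactSpace M.S := isCompact_iff_compactSpace.1 M.isCompact_S
  BoundedContinuousFunction.mkOfCompact
    ⟨M.bellman v, M.continuous_bellman hcont hmoment hδ hr v⟩

theorem contractingWith_bellmanBCF (M : SMDP d D) (hcont : M.ContinuousDensities)
    (hmoment : M.ContinuousShockMoment) (hδ : M.δ < 1) (hr : M.BoundedObservableReward) :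
    ContractingWith M.δ.toNNReal (M.bellmanBCF hcont hmoment hδ hr) := by
  refine ⟨Real.toNNReal_lt_one.2 hδ, LipschitzWith.of_dist_le_mul fun v w => ?_⟩
  rw [Real.coe_toNNReal _ M.δ_pos.le]
  exact (BoundedContinuousFunction.dist_le (mul_nonneg M.δ_pos.le dist_nonneg)).2 fun s =>
    M.abs_bellman_sub_le hmoment v w s

end SMDP

namespace SMDP

variable {d D : ℕ}

/-! ### The Markov property of the state sequence -/

open Preorder in
/-- The joint law of the history up to stage `n` and the next state disintegrates through
`stepKernel`. -/
theorem map_frestrictLe_law_compProd (M : SMDP d D) (μ : M.Policy) (x : M.State) (n : ℕ) :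
    ((M.law μ x).map (frestrictLe (π := fun _ => M.State) n)) ⊗ₘ M.stepKernel μ n =
      (M.law μ x).map fun ω => (frestrictLe (π := fun _ => M.State) n ω, ω (n + 1)) := by
  have h := Kernel.partialTraj_compProd_eq_map_traj (X := fun _ => M.State)
    (κ := M.stepKernel μ) (Nat.zero_le n) (x₀ := fun _ => x)
  rw [← Kernel.traj_map_frestrictLe_apply] at h
  exact h

instance (M : SMDP d D) (μ : M.Policy) (x : M.State) : IsProbabilityMeasure (M.law μ x) := by
  unfold law; infer_instance

theorem ae_law_zero (M : SMDP d D) (μ : M.Policy) (x : M.State) :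
    ∀ᵐ ω ∂(M.law μ x), ω 0 = x := by
  have h := Kernel.traj_map_frestrictLe_apply (X := fun _ => M.State)
    (κ := M.stepKernel μ) 0 0 (fun _ => x)
  rw [Kernel.partialTraj_self, Kernel.id_apply] at h
  have hae : ∀ᵐ y ∂((M.law μ x).map (Preorder.frestrictLe (π := fun _ => M.State) 0)),
      y ⟨0, by simp⟩ = x := by
    rw [law, h, ae_dirac_iff]
    exact measurableSet_eq_fun (measurable_pi_apply _) measurable_const
  exact ae_of_ae_map (Preorder.measurable_frestrictLe 0).aemeasurable hae

theorem lintegral_law_succ (M : SMDP d D) (μ : M.Policy) (x : M.State) (n : ℕ)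
    {f : M.State → ℝ≥0∞} (hf : Measurable f) :
    ∫⁻ ω, f (ω (n + 1)) ∂(M.law μ x) =
      ∫⁻ ω, ∫⁻ y, f y ∂(M.transKernel ((ω n).1, μ.1 n (ω n))) ∂(M.law μ x) := by
  have hr : Measurable (Preorder.frestrictLe (π := fun _ => M.State) n) :=
    Preorder.measurable_frestrictLe n
  have h : ∫⁻ y, f y.2 ∂(((M.law μ x).map (Preorder.frestrictLe (π := fun _ => M.State) n)) ⊗ₘ
      M.stepKernel μ n) = ∫⁻ y, f y.2 ∂((M.law μ x).map
        fun ω => (Preorder.frestrictLe (π := fun _ => M.State) n ω, ω (n + 1))) := by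
    rw [map_frestrictLe_law_compProd]
  have hf2 : Measurable fun z : (Finset.Iic n → M.State) × M.State => f z.2 :=
    hf.comp measurable_snd
  rw [lintegral_map hf2 (hr.prodMk (measurable_pi_apply _)),
    Measure.lintegral_compProd hf2,
    lintegral_map (Measurable.lintegral_kernel hf) hr] at h
  exact h.symm

/-- Conditioning on the history up to stage `n`: a factor that depends only on that history can be
taken out when averaging over the state at stage `n + 1`. -/
theorem integral_law_succ (M : SMDP d D) (μ : M.Policy) (x : M.State) (n : ℕ)
    {f : M.State → ℝ} (hf : Measurable f) {a : (Finset.Iic n → M.State) → ℝ} (ha : Measurable a)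
    (hint : Integrable (fun ω => a (Preorder.frestrictLe n ω) * f (ω (n + 1))) (M.law μ x)) :
    ∫ ω, a (Preorder.frestrictLe n ω) * f (ω (n + 1)) ∂(M.law μ x) =
      ∫ ω, a (Preorder.frestrictLe n ω) *
        ∫ y, f y ∂(M.transKernel ((ω n).1, μ.1 n (ω n))) ∂(M.law μ x) := by
  have hr : Measurable (Preorder.frestrictLe (π := fun _ => M.State) n) :=
    Preorder.measurable_frestrictLe n
  have hF : Measurable fun z : (Finset.Iic n → M.State) × M.State => a z.1 * f z.2 :=
    (ha.comp measurable_fst).mul (hf.comp measurable_snd)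
  have hrp : Measurable fun ω : ℕ → M.State =>
      (Preorder.frestrictLe (π := fun _ => M.State) n ω, ω (n + 1)) :=
    hr.prodMk (measurable_pi_apply _)
  have hcomp := M.map_frestrictLe_law_compProd μ x n
  have hF_int : Integrable (fun z : (Finset.Iic n → M.State) × M.State => a z.1 * f z.2)
      (((M.law μ x).map (Preorder.frestrictLe (π := fun _ => M.State) n)) ⊗ₘ
        M.stepKernel μ n) := by
    rw [hcomp, integrable_map_measure hF.aestronglyMeasurable hrp.aemeasurable]
    exact hint
  have h : ∫ z, a z.1 * f z.2 ∂(((M.law μ x).map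
      (Preorder.frestrictLe (π := fun _ => M.State) n)) ⊗ₘ M.stepKernel μ n) =
      ∫ z, a z.1 * f z.2 ∂((M.law μ x).map
        fun ω => (Preorder.frestrictLe (π := fun _ => M.State) n ω, ω (n + 1))) := by
    rw [hcomp]
  have hG : StronglyMeasurable fun y : Finset.Iic n → M.State =>
      ∫ z, a y * f z ∂(M.stepKernel μ n y) :=
    StronglyMeasurable.integral_kernel_prod_right hF.stronglyMeasurable
  rw [integral_map hrp.aemeasurable hF.aestronglyMeasurable,
    Measure.integral_compProd hF_int,
    integral_map hr.aemeasurable hG.aestronglyMeasurable] at h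
  simp only [integral_const_mul] at h
  exact h.symm

/-! ### Absolute convergence of the discounted return -/

/-- The factor by which rewards at stage `n` are discounted to stage `0`. -/
def discountFactor (M : SMDP d D) (μ : M.Policy) (ω : ℕ → M.State) (n : ℕ) : ℝ :=
  Real.exp (-M.β * ∑ e ∈ Finset.range n, M.t (μ.1 e (ω e)))

theorem discountFactor_succ (M : SMDP d D) (μ : M.Policy) (ω : ℕ → M.State) (n : ℕ) :
    M.discountFactor μ ω (n + 1) =
      M.discountFactor μ ω n * Real.exp (-M.β * M.t (μ.1 n (ω n))) := by
  rw [discountFactor, discountFactor, Finset.sum_range_succ, mul_add, Real.exp_add]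

theorem discountFactor_pos (M : SMDP d D) (μ : M.Policy) (ω : ℕ → M.State) (n : ℕ) :
    0 < M.discountFactor μ ω n :=
  Real.exp_pos _

theorem measurable_discountFactor (M : SMDP d D) (μ : M.Policy) (n : ℕ) :
    Measurable fun ω => M.discountFactor μ ω n :=
  Real.measurable_exp.comp (measurable_const.mul (Finset.measurable_sum _ fun e _ =>
    (measurable_from_top (f := M.t)).comp ((μ.2 e).comp (measurable_pi_apply e))))

theorem measurable_reward (M : SMDP d D) (hr : M.BoundedObservableReward) (α : Fin D) :
    Measurable fun x : M.State => M.r α x.1 + x.2 α :=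
  ((hr α).1.measurable.comp measurable_fst).add ((measurable_pi_apply α).comp measurable_snd)

theorem measurable_stageReward (M : SMDP d D) (hr : M.BoundedObservableReward) (μ : M.Policy)
    (l : ℕ) : Measurable fun x : M.State => M.r (μ.1 l x) x.1 + x.2 (μ.1 l x) := by
  have h : Measurable fun z : M.State × Fin D => M.r z.2 z.1.1 + z.1.2 z.2 :=
    measurable_from_prod_countable_left fun α => M.measurable_reward hr α
  exact h.comp (measurable_id.prodMk (μ.2 l))

theorem measurable_discountedReward (M : SMDP d D) (hr : M.BoundedObservableReward)
    (μ : M.Policy) (l : ℕ) : Measurable fun ω => M.discountedReward μ ω l :=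
  (M.measurable_discountFactor μ l).mul
    ((M.measurable_stageReward hr μ l).comp (measurable_pi_apply l))

variable [NeZero D]

theorem discountFactor_le (M : SMDP d D) (μ : M.Policy) (ω : ℕ → M.State) (n : ℕ) :
    M.discountFactor μ ω n ≤ M.δ ^ n := by
  induction n with
  | zero => simp [discountFactor]
  | succ n ih =>
    rw [discountFactor_succ, pow_succ]
    exact mul_le_mul ih (M.exp_le_δ _) (Real.exp_pos _).le (pow_nonneg M.δ_pos.le n)

theorem R_succ_eq (M : SMDP d D) {l : ℕ} (hl : Measurable (M.R l)) (x : M.State) :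
    M.R (l + 1) x = ⨆ α : Fin D, ∫⁻ y, M.R l y ∂(M.transKernel (x.1, α)) := by
  rw [R]
  refine iSup_congr fun α => ?_
  rw [transKernel, Kernel.lintegral_compProd _ _ _ hl]
  simp only [Kernel.prodMkLeft_apply]

theorem measurable_R (M : SMDP d D) (hr : M.BoundedObservableReward) (l : ℕ) :
    Measurable (M.R l) := by
  induction l with
  | zero =>
    exact (measurable_maxOver fun α => (M.measurable_reward hr α).abs).ennreal_ofReal
  | succ l ih =>
    rw [funext (M.R_succ_eq ih)]
    exact Measurable.iSup fun α =>
      (Measurable.lintegral_kernel ih).comp (measurable_fst.prodMk measurable_const)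

/-- Each step back in time turns `R k` into at most `R (k + 1)`, because the action taken is one of
those over which `R (k + 1)` takes the supremum. -/
theorem lintegral_R_law_le (M : SMDP d D) (hr : M.BoundedObservableReward) (μ : M.Policy)
    (x : M.State) (n k : ℕ) : ∫⁻ ω, M.R k (ω n) ∂(M.law μ x) ≤ M.R (k + n) x := by
  induction n generalizing k with
  | zero =>
    have h : (fun ω => M.R k (ω 0)) =ᵐ[M.law μ x] fun _ => M.R k x :=
      (M.ae_law_zero μ x).mono fun ω h => congrArg (M.R k) h
    rw [lintegral_congr_ae h, lintegral_const, measure_univ, mul_one, add_zero]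
  | succ n ih =>
    rw [M.lintegral_law_succ μ x n (M.measurable_R hr k)]
    refine (lintegral_mono fun ω => ?_).trans ((ih (k + 1)).trans_eq (by congr 1; ring))
    rw [M.R_succ_eq (M.measurable_R hr k)]
    exact le_iSup (fun α => ∫⁻ y, M.R k y ∂(M.transKernel ((ω n).1, α))) _

theorem R_lt_top (M : SMDP d D) (hfin : M.FiniteDiscountedReturn) (l : ℕ) (x : M.State) :
    M.R l x < ∞ := by
  have h := (ENNReal.le_tsum l).trans_lt (hfin x)
  by_contra hcon
  rw [not_lt, top_le_iff] at hcon
  rw [hcon, ENNReal.mul_top (ENNReal.ofReal_pos.2 (pow_pos M.δ_pos l)).ne'] at h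
  exact lt_irrefl _ h

theorem summable_δ_pow_mul_R (M : SMDP d D) (hfin : M.FiniteDiscountedReturn) (x : M.State) :
    Summable fun l => M.δ ^ l * (M.R l x).toReal := by
  refine (ENNReal.summable_toReal (hfin x).ne).congr fun l => ?_
  rw [ENNReal.toReal_mul, ENNReal.toReal_ofReal (pow_nonneg M.δ_pos.le l)]

/-- A function of the state sequence dominated by a multiple of the reward bound at stage `n` plus a
constant is integrable, and its first absolute moment is controlled by `R n` at the initial
state. -/
theorem integrable_law_and_integral_abs_le (M : SMDP d D) (hfin : M.FiniteDiscountedReturn)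
    (hr : M.BoundedObservableReward) (μ : M.Policy) (x : M.State) (n : ℕ)
    {f : (ℕ → M.State) → ℝ} (hf : Measurable f) {C b : ℝ} (hC : 0 ≤ C) (hb : 0 ≤ b)
    (hle : ∀ ω, |f ω| ≤ b * (C + maxOver fun α => |M.r α (ω n).1 + (ω n).2 α|)) :
    Integrable f (M.law μ x) ∧ ∫ ω, |f ω| ∂(M.law μ x) ≤ b * (C + (M.R n x).toReal) := by
  have hlint : ∫⁻ ω, ENNReal.ofReal |f ω| ∂(M.law μ x) ≤
      ENNReal.ofReal (b * (C + (M.R n x).toReal)) := by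
    calc ∫⁻ ω, ENNReal.ofReal |f ω| ∂(M.law μ x)
        ≤ ∫⁻ ω, ENNReal.ofReal b * (ENNReal.ofReal C + M.R 0 (ω n)) ∂(M.law μ x) := by
          refine lintegral_mono fun ω => ?_
          have h0 : 0 ≤ maxOver fun α => |M.r α (ω n).1 + (ω n).2 α| :=
            (abs_nonneg _).trans
              (le_maxOver (fun α => |M.r α (ω n).1 + (ω n).2 α|) 0)
          rw [R, ← ENNReal.ofReal_add hC h0, ← ENNReal.ofReal_mul hb]
          exact ENNReal.ofReal_le_ofReal (hle ω)
      _ = ENNReal.ofReal b * (ENNReal.ofReal C + ∫⁻ ω, M.R 0 (ω n) ∂(M.law μ x)) := by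
          rw [lintegral_const_mul' _ _ ENNReal.ofReal_ne_top,
            lintegral_add_left measurable_const, lintegral_const, measure_univ, mul_one]
      _ ≤ ENNReal.ofReal b * (ENNReal.ofReal C + M.R n x) := by
          gcongr
          simpa using M.lintegral_R_law_le hr μ x n 0
      _ = ENNReal.ofReal (b * (C + (M.R n x).toReal)) := by
          rw [ENNReal.ofReal_mul hb, ENNReal.ofReal_add hC ENNReal.toReal_nonneg,
            ENNReal.ofReal_toReal (M.R_lt_top hfin n x).ne]
  refine ⟨⟨hf.aestronglyMeasurable, ?_⟩, ?_⟩
  · rw [hasFiniteIntegral_iff_norm]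
    exact hlint.trans_lt ENNReal.ofReal_lt_top
  · rw [integral_eq_lintegral_of_nonneg_ae (Filter.Eventually.of_forall fun ω => abs_nonneg _)
      hf.abs.aestronglyMeasurable]
    exact ENNReal.toReal_le_of_le_ofReal
      (mul_nonneg hb (add_nonneg hC ENNReal.toReal_nonneg)) hlint

theorem integrable_discountedReward_and_le (M : SMDP d D) (hfin : M.FiniteDiscountedReturn)
    (hr : M.BoundedObservableReward) (μ : M.Policy) (x : M.State) (l : ℕ) :
    Integrable (fun ω => M.discountedReward μ ω l) (M.law μ x) ∧
      ∫ ω, |M.discountedReward μ ω l| ∂(M.law μ x) ≤ M.δ ^ l * (M.R l x).toReal := by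
  have h := M.integrable_law_and_integral_abs_le hfin hr μ x l
    (M.measurable_discountedReward hr μ l) le_rfl (pow_nonneg M.δ_pos.le l) fun ω => by
      rw [zero_add, discountedReward, abs_mul, abs_of_pos (Real.exp_pos _)]
      exact mul_le_mul (M.discountFactor_le μ ω l)
        (le_maxOver (fun α => |M.r α (ω l).1 + (ω l).2 α|) _) (abs_nonneg _)
        (pow_nonneg M.δ_pos.le l)
  rwa [zero_add] at h

theorem summable_integral_abs_discountedReward (M : SMDP d D) (hfin : M.FiniteDiscountedReturn)
    (hr : M.BoundedObservableReward) (μ : M.Policy) (x : M.State) :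
    Summable fun l => ∫ ω, |M.discountedReward μ ω l| ∂(M.law μ x) :=
  (M.summable_δ_pow_mul_R hfin x).of_nonneg_of_le
    (fun _ => integral_nonneg fun _ => abs_nonneg _)
    fun l => (M.integrable_discountedReward_and_le hfin hr μ x l).2

theorem hasSum_integral_discountedReward (M : SMDP d D) (hfin : M.FiniteDiscountedReturn)
    (hr : M.BoundedObservableReward) (μ : M.Policy) (x : M.State) :
    HasSum (fun l => ∫ ω, M.discountedReward μ ω l ∂(M.law μ x)) (M.expectedReturn μ x) :=
  hasSum_integral_of_summable_integral_norm
    (fun l => (M.integrable_discountedReward_and_le hfin hr μ x l).1)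
    (M.summable_integral_abs_discountedReward hfin hr μ x)

theorem lintegral_tsum_discountedReward_lt_top (M : SMDP d D) (hfin : M.FiniteDiscountedReturn)
    (hr : M.BoundedObservableReward) (μ : M.Policy) (x : M.State) :
    ∫⁻ ω, ∑' l, ‖M.discountedReward μ ω l‖ₑ ∂(M.law μ x) < ∞ := by
  rw [lintegral_tsum fun l => (M.measurable_discountedReward hr μ l).enorm.aemeasurable]
  have h : ∀ l, ∫⁻ ω, ‖M.discountedReward μ ω l‖ₑ ∂(M.law μ x) =
      ENNReal.ofReal (∫ ω, |M.discountedReward μ ω l| ∂(M.law μ x)) := fun l =>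
    (ofReal_integral_norm_eq_lintegral_enorm
      (M.integrable_discountedReward_and_le hfin hr μ x l).1).symm
  simp only [h]
  exact (M.summable_integral_abs_discountedReward hfin hr μ x).tsum_ofReal_lt_top

theorem ae_summable_discountedReward (M : SMDP d D) (hfin : M.FiniteDiscountedReturn)
    (hr : M.BoundedObservableReward) (μ : M.Policy) (x : M.State) :
    ∀ᵐ ω ∂(M.law μ x), Summable fun l => M.discountedReward μ ω l := by
  have hmeas : Measurable fun ω => ∑' l, ‖M.discountedReward μ ω l‖ₑ :=
    Measurable.tsum fun l => (M.measurable_discountedReward hr μ l).enorm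
  filter_upwards [ae_lt_top hmeas (M.lintegral_tsum_discountedReward_lt_top hfin hr μ x).ne]
    with ω hω
  have h : Summable fun l => ‖M.discountedReward μ ω l‖₊ :=
    ENNReal.tsum_coe_ne_top_iff_summable.1 hω.ne
  exact (NNReal.summable_coe.2 h).of_norm

theorem integrable_totalReturn (M : SMDP d D) (hfin : M.FiniteDiscountedReturn)
    (hr : M.BoundedObservableReward) (μ : M.Policy) (x : M.State) :
    Integrable (M.totalReturn μ) (M.law μ x) := by
  refine ⟨(Measurable.tsum fun l => M.measurable_discountedReward hr μ l).aestronglyMeasurable, ?_⟩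
  refine (lintegral_mono fun ω => ?_).trans_lt
    (M.lintegral_tsum_discountedReward_lt_top hfin hr μ x)
  exact enorm_tsum_le_tsum_enorm

end SMDP

namespace SMDP

variable {d D : ℕ}

/-! ### Verification: the value function solves the Bellman equation -/

/-- The expected return of choosing `α` at `x` and collecting the continuation value `v`
(a function of the next observable state) afterwards. -/
def actionValue (M : SMDP d D) (v : M.S → ℝ) (x : M.State) (α : Fin D) : ℝ :=
  M.r α x.1 + Real.exp (-M.β * M.t α) * M.condExpect α v x.1 + x.2 α

theorem measurable_actionValue (M : SMDP d D) (hcont : M.ContinuousDensities)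
    (hr : M.BoundedObservableReward) (v : M.S →ᵇ ℝ) (α : Fin D) :
    Measurable fun x => M.actionValue v x α :=
  (((hr α).1.measurable.comp measurable_fst).add (measurable_const.mul
    ((M.continuous_condExpect hcont v α).measurable.comp measurable_fst))).add
    ((measurable_pi_apply α).comp measurable_snd)

variable [NeZero D]

/-- The value of acting optimally for one stage with continuation value `v`. -/
def optimalActionValue (M : SMDP d D) (v : M.S → ℝ) (x : M.State) : ℝ :=
  maxOver (M.actionValue v x)

theorem measurable_optimalActionValue (M : SMDP d D) (hcont : M.ContinuousDensities)
    (hr : M.BoundedObservableReward) (v : M.S →ᵇ ℝ) : Measurable (M.optimalActionValue v) :=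
  measurable_maxOver (M.measurable_actionValue hcont hr v)

theorem integral_optimalActionValue (M : SMDP d D) (v : M.S → ℝ) (s : M.S) :
    ∫ ε, M.optimalActionValue v (s, ε) ∂(M.shockKernel s) = M.bellman v s :=
  rfl

theorem integrable_optimalActionValue (M : SMDP d D) (hmoment : M.ContinuousShockMoment)
    (v : M.S → ℝ) (s : M.S) :
    Integrable (fun ε => M.optimalActionValue v (s, ε)) (M.shockKernel s) :=
  M.integrable_maxOver_add hmoment s fun α =>
    M.r α s + Real.exp (-M.β * M.t α) * M.condExpect α v s

theorem abs_optimalActionValue_le (M : SMDP d D) (hδ : M.δ < 1) (v : M.S →ᵇ ℝ) (x : M.State) :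
    |M.optimalActionValue v x| ≤ ‖v‖ + maxOver fun α => |M.r α x.1 + x.2 α| :=
  abs_maxOver_le fun α => by
    have h : M.actionValue v x α = Real.exp (-M.β * M.t α) * M.condExpect α v x.1 +
        (M.r α x.1 + x.2 α) := by rw [actionValue]; ring
    rw [h]
    exact (abs_add_le _ _).trans (add_le_add (M.abs_exp_mul_condExpect_le hδ v α x.1)
      (le_maxOver (fun α => |M.r α x.1 + x.2 α|) α))

theorem abs_optimalActionValue_le_norm (M : SMDP d D) (hδ : M.δ < 1) {C : ℝ}
    (hC : ∀ α s, |M.r α s| ≤ C) (v : M.S →ᵇ ℝ) (x : M.State) :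
    |M.optimalActionValue v x| ≤ (C + ‖v‖) + ‖x.2‖ :=
  abs_maxOver_add_le fun α => (abs_add_le _ _).trans
    (add_le_add (hC α x.1) (M.abs_exp_mul_condExpect_le hδ v α x.1))

/-- Integrability comes from the boundedness of the first absolute moment of the shocks, a
continuous function on a compact set. -/
theorem integrable_transKernel_optimalActionValue (M : SMDP d D) (hcont : M.ContinuousDensities)
    (hmoment : M.ContinuousShockMoment) (hδ : M.δ < 1) (hr : M.BoundedObservableReward)
    (v : M.S →ᵇ ℝ) (z : M.S × Fin D) :
    Integrable (M.optimalActionValue v) (M.transKernel z) := by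
  have : CompactSpace M.S := isCompact_iff_compactSpace.1 M.isCompact_S
  obtain ⟨C, hC⟩ := hr.exists_bound
  let m : M.S →ᵇ ℝ := BoundedContinuousFunction.mkOfCompact ⟨_, hmoment.continuous⟩
  have hnorm : AEStronglyMeasurable (fun y : M.State => ‖y.2‖) (M.transKernel z) :=
    (measurable_norm.comp measurable_snd).aestronglyMeasurable
  have hint : Integrable (fun y : M.State => ‖y.2‖) (M.transKernel z) := by
    rw [transKernel] at hnorm ⊢
    rw [ProbabilityTheory.integrable_compProd_iff hnorm]
    refine ⟨Filter.Eventually.of_forall fun s' => hmoment.integrable s', ?_⟩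
    simp only [Kernel.prodMkLeft_apply, norm_norm]
    exact m.integrable _
  exact ((integrable_const (C + ‖v‖)).add hint).mono'
    (M.measurable_optimalActionValue hcont hr v).aestronglyMeasurable
    (Filter.Eventually.of_forall fun y => M.abs_optimalActionValue_le_norm hδ hC v y)

/-- For a fixed point `v` of the expected Bellman operator, averaging the optimal action value over
the next full state recovers `E_α v`. -/
theorem integral_transKernel_optimalActionValue (M : SMDP d D) (hcont : M.ContinuousDensities)
    (hmoment : M.ContinuousShockMoment) (hδ : M.δ < 1) (hr : M.BoundedObservableReward)
    {v : M.S →ᵇ ℝ} (hv : ∀ s, M.bellman v s = v s) (s : M.S) (α : Fin D) :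
    ∫ y, M.optimalActionValue v y ∂(M.transKernel (s, α)) = M.condExpect α v s := by
  have hint := M.integrable_transKernel_optimalActionValue hcont hmoment hδ hr v (s, α)
  rw [transKernel] at hint ⊢
  rw [ProbabilityTheory.integral_compProd hint, condExpect]
  refine integral_congr_ae (Filter.Eventually.of_forall fun s' => ?_)
  simp only [Kernel.prodMkLeft_apply]
  rw [integral_optimalActionValue, hv]

theorem integrable_discountFactor_mul (M : SMDP d D) (hcont : M.ContinuousDensities)
    (hfin : M.FiniteDiscountedReturn) (hδ : M.δ < 1) (hr : M.BoundedObservableReward)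
    (v : M.S →ᵇ ℝ) (μ : M.Policy) (x : M.State) (n : ℕ) :
    Integrable (fun ω => M.discountFactor μ ω n * M.optimalActionValue v (ω n)) (M.law μ x) ∧
      ∫ ω, |M.discountFactor μ ω n * M.optimalActionValue v (ω n)| ∂(M.law μ x) ≤
        M.δ ^ n * (‖v‖ + (M.R n x).toReal) :=
  M.integrable_law_and_integral_abs_le hfin hr μ x n
    ((M.measurable_discountFactor μ n).mul
      ((M.measurable_optimalActionValue hcont hr v).comp (measurable_pi_apply n)))
    (norm_nonneg v) (pow_nonneg M.δ_pos.le n) fun ω => by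
      change |M.discountFactor μ ω n * M.optimalActionValue v (ω n)| ≤ _
      rw [abs_mul, abs_of_pos (M.discountFactor_pos μ ω n)]
      exact mul_le_mul (M.discountFactor_le μ ω n) (M.abs_optimalActionValue_le hδ v (ω n))
        (abs_nonneg _) (pow_nonneg M.δ_pos.le n)

/-- The discounted optimal action value at the current stage, averaged over the law of the state
sequence, vanishes in the long run. -/
theorem tendsto_integral_discountFactor_mul (M : SMDP d D) (hcont : M.ContinuousDensities)
    (hfin : M.FiniteDiscountedReturn) (hδ : M.δ < 1) (hr : M.BoundedObservableReward)
    (v : M.S →ᵇ ℝ) (μ : M.Policy) (x : M.State) :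
    Filter.Tendsto
      (fun n => ∫ ω, M.discountFactor μ ω n * M.optimalActionValue v (ω n) ∂(M.law μ x))
      Filter.atTop (nhds 0) := by
  have hlim : Filter.Tendsto (fun n => M.δ ^ n * (‖v‖ + (M.R n x).toReal)) Filter.atTop
      (nhds 0) := by
    have h := ((tendsto_pow_atTop_nhds_zero_of_lt_one M.δ_pos.le hδ).mul_const ‖v‖).add
      (M.summable_δ_pow_mul_R hfin x).tendsto_atTop_zero
    simpa only [zero_mul, add_zero, ← mul_add] using h
  exact squeeze_zero_norm (fun n => (abs_integral_le_integral_abs).trans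
    (M.integrable_discountFactor_mul hcont hfin hδ hr v μ x n).2) hlim

/-- One step of dynamic programming along a policy: the reward at stage `n` together with the
optimal action value at stage `n + 1` averages to the value at stage `n` of the action that the
policy takes. -/
theorem integral_discountedReward_add (M : SMDP d D) (hcont : M.ContinuousDensities)
    (hmoment : M.ContinuousShockMoment) (hfin : M.FiniteDiscountedReturn) (hδ : M.δ < 1)
    (hr : M.BoundedObservableReward) {v : M.S →ᵇ ℝ} (hv : ∀ s, M.bellman v s = v s)
    (μ : M.Policy) (x : M.State) (n : ℕ) :
    Integrable (fun ω => M.discountFactor μ ω n * M.actionValue v (ω n) (μ.1 n (ω n)))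
        (M.law μ x) ∧
      ∫ ω, M.discountedReward μ ω n ∂(M.law μ x) +
        ∫ ω, M.discountFactor μ ω (n + 1) * M.optimalActionValue v (ω (n + 1)) ∂(M.law μ x) =
      ∫ ω, M.discountFactor μ ω n * M.actionValue v (ω n) (μ.1 n (ω n)) ∂(M.law μ x) := by
  -- The discount factor of stage `n + 1` as a function of the history up to stage `n`.
  let a : (Finset.Iic n → M.State) → ℝ := fun h =>
    Real.exp (-M.β * ∑ e : Finset.Iic n, M.t (μ.1 e (h e)))
  have ha : Measurable a :=
    Real.measurable_exp.comp (measurable_const.mul (Finset.measurable_sum _ fun e _ =>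
      (measurable_from_top (f := M.t)).comp ((μ.2 e).comp (measurable_pi_apply e))))
  have hae : ∀ ω : ℕ → M.State,
      a (Preorder.frestrictLe n ω) = M.discountFactor μ ω (n + 1) := fun ω => by
    have h : Finset.range (n + 1) = Finset.Iic n := by
      ext i; simp
    simp only [a, discountFactor, h]
    rw [← Finset.sum_coe_sort (Finset.Iic n)]
    rfl
  have hstep := M.integral_law_succ μ x n (M.measurable_optimalActionValue hcont hr v) ha
    (by
      simp only [hae]
      exact (M.integrable_discountFactor_mul hcont hfin hδ hr v μ x (n + 1)).1)
  simp only [hae, M.integral_transKernel_optimalActionValue hcont hmoment hδ hr hv] at hstep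
  have hmeasE : Measurable fun y : M.State => M.condExpect (μ.1 n y) v y.1 := by
    have h : Measurable fun z : M.State × Fin D => M.condExpect z.2 v z.1.1 :=
      measurable_from_prod_countable_left fun α =>
        (M.continuous_condExpect hcont v α).measurable.comp measurable_fst
    exact h.comp (measurable_id.prodMk (μ.2 n))
  have hE : Integrable (fun ω => M.discountFactor μ ω (n + 1) *
      M.condExpect (μ.1 n (ω n)) v (ω n).1) (M.law μ x) := by
    refine (integrable_const (M.δ ^ (n + 1) * ‖v‖)).mono'
      ((M.measurable_discountFactor μ (n + 1)).mul
        (hmeasE.comp (measurable_pi_apply n))).aestronglyMeasurable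
      (Filter.Eventually.of_forall fun ω => ?_)
    rw [norm_mul, Real.norm_of_nonneg (M.discountFactor_pos μ ω _).le]
    exact mul_le_mul (M.discountFactor_le μ ω _) (M.abs_condExpect_le v _ _) (norm_nonneg _)
      (pow_nonneg M.δ_pos.le _)
  have hR := (M.integrable_discountedReward_and_le hfin hr μ x n).1
  have hsum : ∀ ω, M.discountedReward μ ω n +
      M.discountFactor μ ω (n + 1) * M.condExpect (μ.1 n (ω n)) v (ω n).1 =
      M.discountFactor μ ω n * M.actionValue v (ω n) (μ.1 n (ω n)) := fun ω => by
    rw [discountFactor_succ, actionValue, discountedReward, discountFactor]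
    ring
  rw [hstep, ← integral_add hR hE]
  simp only [hsum]
  exact ⟨(hR.add hE).congr (Filter.Eventually.of_forall hsum), trivial⟩

theorem integral_discountFactor_mul_zero (M : SMDP d D) (v : M.S → ℝ) (μ : M.Policy)
    (x : M.State) :
    ∫ ω, M.discountFactor μ ω 0 * M.optimalActionValue v (ω 0) ∂(M.law μ x) =
      M.optimalActionValue v x := by
  have h : (fun ω => M.discountFactor μ ω 0 * M.optimalActionValue v (ω 0)) =ᵐ[M.law μ x]
      fun _ => M.optimalActionValue v x :=
    (M.ae_law_zero μ x).mono fun ω h => by simp [discountFactor, h]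
  rw [integral_congr_ae h, integral_const, probReal_univ, one_smul]

/-- No policy earns more than the optimal action value of a fixed point. -/
theorem expectedReturn_le (M : SMDP d D) (hcont : M.ContinuousDensities)
    (hmoment : M.ContinuousShockMoment) (hfin : M.FiniteDiscountedReturn) (hδ : M.δ < 1)
    (hr : M.BoundedObservableReward) {v : M.S →ᵇ ℝ} (hv : ∀ s, M.bellman v s = v s)
    (μ : M.Policy) (x : M.State) : M.expectedReturn μ x ≤ M.optimalActionValue v x := by
  have hpartial : ∀ n, ∑ l ∈ Finset.range n, ∫ ω, M.discountedReward μ ω l ∂(M.law μ x) +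
      ∫ ω, M.discountFactor μ ω n * M.optimalActionValue v (ω n) ∂(M.law μ x) ≤
        M.optimalActionValue v x := fun n => by
    induction n with
    | zero => simp [integral_discountFactor_mul_zero]
    | succ n ih =>
      obtain ⟨hint, heq⟩ := M.integral_discountedReward_add hcont hmoment hfin hδ hr hv μ x n
      rw [Finset.sum_range_succ, add_assoc, heq]
      refine le_trans (add_le_add le_rfl ?_) ih
      exact integral_mono hint (M.integrable_discountFactor_mul hcont hfin hδ hr v μ x n).1
        fun ω => mul_le_mul_of_nonneg_left (le_maxOver _ _) (M.discountFactor_pos μ ω n).le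
  have hlim := (M.hasSum_integral_discountedReward hfin hr μ x).tendsto_sum_nat.add
    (M.tendsto_integral_discountFactor_mul hcont hfin hδ hr v μ x)
  rw [add_zero] at hlim
  exact le_of_tendsto hlim (Filter.Eventually.of_forall hpartial)

/-- A stationary policy that always picks a maximizing action earns exactly the optimal action
value of a fixed point. -/
theorem expectedReturn_eq_of_greedy (M : SMDP d D) (hcont : M.ContinuousDensities)
    (hmoment : M.ContinuousShockMoment) (hfin : M.FiniteDiscountedReturn) (hδ : M.δ < 1)
    (hr : M.BoundedObservableReward) {v : M.S →ᵇ ℝ} (hv : ∀ s, M.bellman v s = v s)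
    {μ : M.Policy} (hμ : ∀ l y, M.actionValue v y (μ.1 l y) = M.optimalActionValue v y)
    (x : M.State) : M.expectedReturn μ x = M.optimalActionValue v x := by
  have hpartial : ∀ n, ∑ l ∈ Finset.range n, ∫ ω, M.discountedReward μ ω l ∂(M.law μ x) +
      ∫ ω, M.discountFactor μ ω n * M.optimalActionValue v (ω n) ∂(M.law μ x) =
        M.optimalActionValue v x := fun n => by
    induction n with
    | zero => simp [integral_discountFactor_mul_zero]
    | succ n ih =>
      rw [Finset.sum_range_succ, add_assoc,
        (M.integral_discountedReward_add hcont hmoment hfin hδ hr hv μ x n).2, ← ih]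
      simp only [hμ]
  have hlim := (M.hasSum_integral_discountedReward hfin hr μ x).tendsto_sum_nat.add
    (M.tendsto_integral_discountFactor_mul hcont hfin hδ hr v μ x)
  simp only [hpartial, add_zero] at hlim
  exact tendsto_nhds_unique hlim tendsto_const_nhds

theorem exists_greedy_policy (M : SMDP d D) (hcont : M.ContinuousDensities)
    (hr : M.BoundedObservableReward) (v : M.S →ᵇ ℝ) :
    ∃ μ : M.Policy, ∀ l y, M.actionValue v y (μ.1 l y) = M.optimalActionValue v y := by
  obtain ⟨g, hg, hmax⟩ := exists_measurable_eq_maxOver (M.measurable_actionValue hcont hr v)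
  exact ⟨⟨fun _ => g, fun _ => hg⟩, fun _ y => hmax y⟩

theorem V_eq_optimalActionValue (M : SMDP d D) (hcont : M.ContinuousDensities)
    (hmoment : M.ContinuousShockMoment) (hfin : M.FiniteDiscountedReturn) (hδ : M.δ < 1)
    (hr : M.BoundedObservableReward) {v : M.S →ᵇ ℝ} (hv : ∀ s, M.bellman v s = v s)
    (x : M.State) : M.V x = M.optimalActionValue v x := by
  obtain ⟨μ, hμ⟩ := M.exists_greedy_policy hcont hr v
  have hg : IsGreatest (Set.range fun μ : M.Policy => M.expectedReturn μ x)
      (M.optimalActionValue v x) :=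
    ⟨⟨μ, M.expectedReturn_eq_of_greedy hcont hmoment hfin hδ hr hv hμ x⟩, by
      rintro _ ⟨μ', rfl⟩
      exact M.expectedReturn_le hcont hmoment hfin hδ hr hv μ' x⟩
  exact hg.csSup_eq

end SMDP

end

theorem mainTheorem5 {d D : ℕ} [NeZero D] (M : SMDP d D)
    (hcont : M.ContinuousDensities) (hmoment : M.ContinuousShockMoment)
    (hfin : M.FiniteDiscountedReturn) (hδ : M.δ < 1) (hr : M.BoundedObservableReward) :
    (∀ (μ : M.Policy) (x : M.State),
      (∀ᵐ ω ∂(M.law μ x), Summable fun l => M.discountedReward μ ω l) ∧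
        Integrable (M.totalReturn μ) (M.law μ x)) ∧
    (∀ x : M.State, BddAbove (Set.range fun μ : M.Policy => M.expectedReturn μ x)) ∧
    ∃ Λ : (M.S →ᵇ ℝ) → (M.S →ᵇ ℝ),
      (∀ v s, Λ v s = M.bellman v s) ∧
      ContractingWith M.δ.toNNReal Λ ∧
      ∃ v : M.S →ᵇ ℝ,
        Λ v = v ∧
        (∀ w, Λ w = w → w = v) ∧
        (∀ s, Integrable (fun ε => M.V (s, ε)) (M.shockKernel s) ∧
          v s = ∫ ε, M.V (s, ε) ∂(M.shockKernel s)) ∧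
        ∀ s ε, M.V (s, ε) =
          SMDP.maxOver fun α =>
            M.r α s + Real.exp (-M.β * M.t α) * M.condExpect α v s + ε α := by
  have hΛ := M.contractingWith_bellmanBCF hcont hmoment hδ hr
  have hfix := hΛ.fixedPoint_isFixedPt
  set v := ContractingWith.fixedPoint (M.bellmanBCF hcont hmoment hδ hr) hΛ
  have hv : ∀ s, M.bellman v s = v s := fun s => DFunLike.congr_fun hfix s
  have hV := M.V_eq_optimalActionValue hcont hmoment hfin hδ hr hv
  refine ⟨fun μ x => ⟨M.ae_summable_discountedReward hfin hr μ x,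
      M.integrable_totalReturn hfin hr μ x⟩,
    fun x => ⟨M.optimalActionValue v x, ?_⟩,
    M.bellmanBCF hcont hmoment hδ hr, fun _ _ => rfl, hΛ, v, hfix,
    fun w hw => hΛ.fixedPoint_unique hw, fun s => ?_, fun s ε => hV (s, ε)⟩
  · rintro _ ⟨μ, rfl⟩
    exact M.expectedReturn_le hcont hmoment hfin hδ hr hv μ x
  · simp only [hV]
    exact ⟨M.integrable_optimalActionValue hmoment v s,
      (hv s).symm.trans (M.integral_optimalActionValue v s).symm⟩
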